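/- Let $P$ and $Q$ be discrete memoryless channels with input alphabet $\{0,1\}$ and finite output alphabets. For a channel $W\in\{P,Q\}$ and $s\in[0,1]$ let $$\mu_W(s)=\ln\sum_{y}W(y|0)^{1-s}\,W(y|1)^{s}\in[-\infty,0],$$ where the sum is over the $y$ with $W(y|0)>0$ and $W(y|1)>0$ (so that the values at $s=0,1$ are the limits from $(0,1)$), and $\ln 0=-\infty$. For $\gamma\in[0,1]$ let $p_n(\gamma)$ be the smallest probability of error, over all pairs of codewords and all decoders, with which a message $\Theta$, uniformly distributed on $\{0,1\}$, can be communicated by $\lfloor\gamma n\rfloor$ independent uses of $P$ followed by $n-\lfloor\gamma n\rfloor$ independent uses of $Q$ without feedback, and let $$E_1(P,Q,\gamma)=\limsup_{n\to\infty}-\tfrac1n\ln p_n(\gamma)\in[0,+\infty]$$ be the corresponding best error exponent. Suppose that $\mu_P(s)\le\mu_P(1-s)$ and $\mu_Q(s)\le\mu_Q(1-s)$ for all $s\in[0,\tfrac12]$. Then for every $\gamma\in[0,1]$ the upper limit that defines $E_1(P,Q,\gamma)$ is a limit, and $$\min_{\gamma\in[0,1]}E_1(P,Q,\gamma)=-\min_{s\in[0,1]}\max\big(\mu_P(s),\mu_Q(s)\big),$$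 where both minima are attained. -/

import Mathlib

open Set Filter Topology

noncomputable section

namespace TwoRound

/-- A discrete memoryless channel with input alphabet `{0, 1}` and finite output alphabet `Y`,
given by its transition probabilities: `W.prob x y` is the probability of the output `y` when
the input is `x`. -/
structure BinaryDMC (Y : Type*) [Fintype Y] where
  prob : Fin 2 → Y → ℝ
  prob_nonneg : ∀ x y, 0 ≤ prob x y
  sum_prob : ∀ x, ∑ y, prob x y = 1

/-- The natural logarithm of a nonnegative real, with values in the extended reals
(`ln 0 = -∞`). -/
def extLog (r : ℝ) : EReal := ENNReal.log (ENNReal.ofReal r)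

section OneChannel

variable {Y : Type*} [Fintype Y]

open Classical in
/-- `ρ(A, B, s) = ∑ x, A(x)^(1-s) B(x)^s`. The sum is restricted to the common support of `A` and
`B`. This changes nothing for `0 < s < 1` (see `rho_eq_sum`), and at `s = 0` and `s = 1` it gives
the extension by continuity (see `continuous_rho`), for instance
`ρ(A, B, 0) = ∑ x, A(x) 1{B(x) > 0}`. -/
def rho (A B : Y → ℝ) (s : ℝ) : ℝ :=
  ∑ x, if A x ≠ 0 ∧ B x ≠ 0 then A x ^ (1 - s) * B x ^ s else 0

theorem rho_eq_sum (A B : Y → ℝ) {s : ℝ} (hs : s ∈ Ioo (0 : ℝ) 1) :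
    rho A B s = ∑ x, A x ^ (1 - s) * B x ^ s := by
  unfold rho
  refine Finset.sum_congr rfl fun x _ => ?_
  split_ifs with h
  · rfl
  · rw [not_and_or, not_not, not_not] at h
    rcases h with h | h
    · rw [h, Real.zero_rpow (by linarith [hs.2]), zero_mul]
    · rw [h, Real.zero_rpow (by linarith [hs.1]), mul_zero]

theorem continuous_rho (A B : Y → ℝ) : Continuous (rho A B) := by
  unfold rho
  refine continuous_finsetSum _ fun x _ => ?_
  split_ifs with h
  · exact ((continuous_const.rpow (continuous_const.sub continuous_id) fun _ => Or.inl h.1)).mul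
      (continuous_const.rpow continuous_id fun _ => Or.inl h.2)
  · exact continuous_const

/-- `μ_W(s) = ln ρ(W(·|0), W(·|1), s)`, equal to `-∞` when the two output distributions have
disjoint supports. -/
def mu (W : BinaryDMC Y) (s : ℝ) : EReal := extLog (rho (W.prob 0) (W.prob 1) s)

/-- The probability `W^k(y | x)` of receiving the word `y` when the word `x` is sent through
`k` independent uses of `W`. -/
def wordProb (W : BinaryDMC Y) {k : ℕ} (x : Fin k → Fin 2) (y : Fin k → Y) : ℝ :=
  ∏ i, W.prob (x i) (y i)

end OneChannel

section TwoChannels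

variable {Y Z : Type*} [Fintype Y] [Fintype Z]

/-- For all `s ∈ [0, 1/2]`, `μ_P(s) ≤ μ_P(1 - s)` and `μ_Q(s) ≤ μ_Q(1 - s)`. -/
def FlipAssumption (P : BinaryDMC Y) (Q : BinaryDMC Z) : Prop :=
  ∀ s ∈ Icc (0 : ℝ) (1 / 2), mu P s ≤ mu P (1 - s) ∧ mu Q s ≤ mu Q (1 - s)

/-- A code without feedback for `a` uses of a channel with output alphabet `Y` followed by `b` uses
of a channel with output alphabet `Z`. The codeword of each message `θ ∈ {0, 1}` is a pair of
words that depends on `θ` only; the receiver estimates `θ` from all the outputs. -/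
structure Code (Y Z : Type*) (a b : ℕ) where
  enc : Fin 2 → (Fin a → Fin 2) × (Fin b → Fin 2)
  dec : (Fin a → Y) × (Fin b → Z) → Fin 2

/-- The probability that the estimate differs from the message, for a message that is uniformly
distributed on `{0, 1}`. -/
def errorProb (P : BinaryDMC Y) (Q : BinaryDMC Z) {a b : ℕ} (c : Code Y Z a b) : ℝ :=
  ∑ θ : Fin 2, (1 / 2 : ℝ) * ∑ y : Fin a → Y, ∑ z : Fin b → Z,
    if c.dec (y, z) ≠ θ then wordProb P (c.enc θ).1 y * wordProb Q (c.enc θ).2 z else 0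

/-- The smallest error probability with `a` uses of `P` followed by `b` uses of `Q`, without
feedback. There are finitely many codes and at least one, so this infimum is a minimum. -/
def minErrorProb (P : BinaryDMC Y) (Q : BinaryDMC Z) (a b : ℕ) : ℝ :=
  ⨅ c : Code Y Z a b, errorProb P Q c

/-- `-(1/n) ln p`, where `p` is the smallest error probability without feedback with `⌊γ n⌋` uses
of `P` followed by `n - ⌊γ n⌋` uses of `Q`. It is `+∞` if `p = 0` (and `n > 0`). -/
def finiteExponent (P : BinaryDMC Y) (Q : BinaryDMC Z) (γ : ℝ) (n : ℕ) : EReal :=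
  -extLog (minErrorProb P Q ⌊γ * n⌋₊ (n - ⌊γ * n⌋₊)) / (n : EReal)

/-- `E₁(P, Q, γ)`: the best error exponent, as `n → ∞`, of the two-round scheme without
feedback. -/
def E1 (P : BinaryDMC Y) (Q : BinaryDMC Z) (γ : ℝ) : EReal :=
  limsup (finiteExponent P Q γ) atTop

end TwoChannels

end TwoRound

end

/-! For codewords with output laws `A` and `B`, the best decoder errs with probability `1/2 * ∑ min
(A x) (B x)`. On the exponential scale this is the minimum of `rho A B s` over `s ∈ [0, 1]`. One
direction is Chernoff's bound (`sum_min_le_rho`). The converse (`le_sum_min`) passes to the tilted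
weights `A^(1-s) B^s` at a minimizer `s` and discards the outputs with a large log-likelihood ratio
by a second exponential bound; the logarithm of `rho` grows only quadratically there (`LogTaylor`).

Since `rho` factorizes over the channel uses, each use of `W` contributes `1`, `ρ_W(s)` or `ρ_W(1 -
s)`. The flip assumption makes `ρ_W(min s (1 - s))` the smallest of these for both channels at once,
so asymptotically no code beats the constant codewords `0…0` and `1…1`. When both `μ` are finite,
`E₁(γ)` is therefore `-min_s (γ μ_P(s) + (1 - γ) μ_Q(s))`.

This combination is convex in `s` and affine in `γ`, so Sion's theorem exchanges the optimizations
(`exists_saddle`), and the maximum over `γ` is `max(μ_P, μ_Q)`. The bound valid for every `γ` is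
elementary (`neg_max_mu_le_finiteExponent`). A channel with disjoint output supports makes the error
vanish as soon as it is used, which leaves only endpoint cases. -/

noncomputable section

namespace TwoRound

/-! ### Chernoff's bound and its converse for a pair of finite measures. -/

section FiniteMeasures

variable {Ω : Type*} [Fintype Ω]

open Classical in
/-- The restriction of `A` to the common support of `A` and `B`. -/
def common (A B : Ω → ℝ) (x : Ω) : ℝ := if A x ≠ 0 ∧ B x ≠ 0 then A x else 0

/-- The log-likelihood ratio of `B` with respect to `A`. -/
def logRatio (A B : Ω → ℝ) (x : Ω) : ℝ := Real.log (B x / A x)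

theorem common_nonneg {Ω : Type*} {A B : Ω → ℝ} (hA : ∀ x, 0 ≤ A x) (x : Ω) : 0 ≤ common A B x := by
  unfold common
  split_ifs
  exacts [hA x, le_rfl]

/-- Exhibits `rho` as a moment generating function of the log-likelihood ratio, the form in which
tilting, convexity and derivatives are computed. -/
theorem rho_eq_sum_exp {A B : Ω → ℝ} (hA : ∀ x, 0 ≤ A x) (hB : ∀ x, 0 ≤ B x) (s : ℝ) :
    rho A B s = ∑ x, common A B x * Real.exp (s * logRatio A B x) := by
  unfold rho
  refine Finset.sum_congr rfl fun x _ => ?_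
  unfold common logRatio
  split_ifs with h
  · have ha := (hA x).lt_of_ne' h.1
    have hb := (hB x).lt_of_ne' h.2
    rw [Real.rpow_sub ha, Real.rpow_one, div_mul_eq_mul_div, mul_div_assoc,
      ← Real.div_rpow hb.le ha.le, Real.rpow_def_of_pos (div_pos hb ha), mul_comm s]
  · simp

theorem rho_nonneg {A B : Ω → ℝ} (hA : ∀ x, 0 ≤ A x) (hB : ∀ x, 0 ≤ B x) (s : ℝ) :
    0 ≤ rho A B s := by
  rw [rho_eq_sum_exp hA hB]
  exact Finset.sum_nonneg fun x _ => mul_nonneg (common_nonneg hA x) (Real.exp_pos _).le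

theorem rho_swap (A B : Ω → ℝ) (s : ℝ) : rho B A s = rho A B (1 - s) := by
  unfold rho
  refine Finset.sum_congr rfl fun x _ => ?_
  rw [sub_sub_cancel, mul_comm]
  simp only [and_comm]

theorem rho_self {A : Ω → ℝ} (hA : ∀ x, 0 ≤ A x) (hA1 : ∑ x, A x = 1) (s : ℝ) :
    rho A A s = 1 := by
  rw [rho_eq_sum_exp hA hA, ← hA1]
  refine Finset.sum_congr rfl fun x _ => ?_
  unfold common logRatio
  by_cases h : A x = 0 <;> simp [h]

theorem rho_le_one {A B : Ω → ℝ} (hA : ∀ x, 0 ≤ A x) (hB : ∀ x, 0 ≤ B x)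
    (hA1 : ∑ x, A x = 1) (hB1 : ∑ x, B x = 1) {s : ℝ} (hs : s ∈ Icc (0 : ℝ) 1) :
    rho A B s ≤ 1 := by
  calc rho A B s ≤ ∑ x, ((1 - s) * A x + s * B x) := by
        refine Finset.sum_le_sum fun x _ => ?_
        split_ifs with h
        · exact Real.geom_mean_le_arith_mean2_weighted (by linarith [hs.2]) hs.1 (hA x) (hB x)
            (by ring)
        · have h1 := hA x
          have h2 := hB x
          have h3 : 0 ≤ 1 - s := by linarith [hs.2]
          have h4 := hs.1
          positivity
    _ = 1 := by
        rw [Finset.sum_add_distrib, ← Finset.mul_sum, ← Finset.mul_sum, hA1, hB1]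
        ring

/-- If `rho A B` vanishes at one point, then the supports of `A` and `B` are disjoint. -/
theorem rho_eq_zero_of_eq_zero {A B : Ω → ℝ} (hA : ∀ x, 0 ≤ A x) (hB : ∀ x, 0 ≤ B x) {s : ℝ}
    (h : rho A B s = 0) (t : ℝ) : rho A B t = 0 := by
  rw [rho_eq_sum_exp hA hB] at h ⊢
  rw [Finset.sum_eq_zero_iff_of_nonneg fun x _ =>
    mul_nonneg (common_nonneg hA x) (Real.exp_pos _).le] at h
  refine Finset.sum_eq_zero fun x hx => ?_
  rcases mul_eq_zero.1 (h x hx) with h | h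
  · rw [h, zero_mul]
  · exact absurd h (Real.exp_pos _).ne'

/-- Hölder's inequality, obtained from convexity of `exp` after normalizing both exponential weights
to total mass one. -/
theorem convexOn_log_rho {A B : Ω → ℝ} (hA : ∀ x, 0 ≤ A x) (hB : ∀ x, 0 ≤ B x)
    (hpos : ∀ s, 0 < rho A B s) : ConvexOn ℝ univ fun s => Real.log (rho A B s) := by
  refine ⟨convex_univ, fun s _ t _ a b ha hb hab => ?_⟩
  simp only [smul_eq_mul]
  rw [Real.log_le_iff_le_exp (hpos _)]
  set u := Real.log (rho A B s) with hu
  set v := Real.log (rho A B t) with hv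
  have key : ∀ x, Real.exp ((a * s + b * t) * logRatio A B x) ≤ Real.exp (a * u + b * v) *
      (a * (Real.exp (s * logRatio A B x) * Real.exp (-u)) +
        b * (Real.exp (t * logRatio A B x) * Real.exp (-v))) := fun x => by
    have := convexOn_exp.2 (mem_univ (s * logRatio A B x - u)) (mem_univ (t * logRatio A B x - v))
      ha hb hab
    simp only [smul_eq_mul, sub_eq_add_neg, Real.exp_add _ (-u), Real.exp_add _ (-v)] at this
    refine le_trans (le_of_eq ?_) (mul_le_mul_of_nonneg_left this (Real.exp_pos _).le)
    rw [← Real.exp_add]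
    congr 1
    ring
  calc rho A B (a * s + b * t)
      ≤ ∑ x, Real.exp (a * u + b * v) *
        (a * Real.exp (-u) * (common A B x * Real.exp (s * logRatio A B x)) +
        b * Real.exp (-v) * (common A B x * Real.exp (t * logRatio A B x))) := by
        rw [rho_eq_sum_exp hA hB]
        refine Finset.sum_le_sum fun x _ => ?_
        refine (mul_le_mul_of_nonneg_left (key x) (common_nonneg hA x)).trans (le_of_eq ?_)
        ring
    _ = Real.exp (a * u + b * v) := by
        rw [← Finset.mul_sum, Finset.sum_add_distrib, ← Finset.mul_sum, ← Finset.mul_sum,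
          ← rho_eq_sum_exp hA hB, ← rho_eq_sum_exp hA hB, Real.exp_neg, Real.exp_neg, hu, hv,
          Real.exp_log (hpos s), Real.exp_log (hpos t), mul_assoc, mul_assoc,
          inv_mul_cancel₀ (hpos s).ne', inv_mul_cancel₀ (hpos t).ne']
        simp [hab]

/-- Chernoff's upper bound. -/
theorem sum_min_le_rho {A B : Ω → ℝ} (hA : ∀ x, 0 ≤ A x) (hB : ∀ x, 0 ≤ B x) {s : ℝ}
    (hs : s ∈ Icc (0 : ℝ) 1) : ∑ x, min (A x) (B x) ≤ rho A B s := by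
  rw [rho_eq_sum_exp hA hB]
  refine Finset.sum_le_sum fun x _ => ?_
  unfold common logRatio
  split_ifs with h
  · have ha := (hA x).lt_of_ne' h.1
    have hb := (hB x).lt_of_ne' h.2
    set D := Real.log (B x / A x) with hD
    have hBx : B x = A x * Real.exp D := by
      rw [hD, Real.exp_log (div_pos hb ha)]; field_simp
    rcases le_total 0 D with h0 | h0
    · refine (min_le_left _ _).trans (le_mul_of_one_le_right ha.le ?_)
      exact Real.one_le_exp (mul_nonneg hs.1 h0)
    · refine (min_le_right _ _).trans ?_
      rw [hBx]
      gcongr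
      nlinarith [hs.2]
  · rw [zero_mul]
    rw [not_and_or, not_not, not_not] at h
    rcases h with h | h
    · exact (min_le_left _ _).trans h.le
    · exact (min_le_right _ _).trans h.le

/-- A converse to Chernoff's bound: if moving away from `s` by `l`, in the directions that stay
inside `[0, 1]`, increases `rho A B` by a factor of at most `exp c`, then `∑ x, min (A x) (B x)`
is not much smaller than `rho A B s`. -/
theorem le_sum_min {A B : Ω → ℝ} (hA : ∀ x, 0 ≤ A x) (hB : ∀ x, 0 ≤ B x) {s l c δ : ℝ}
    (hs : s ∈ Icc (0 : ℝ) 1) (hl : 0 ≤ l) (hδ : 0 ≤ δ)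
    (hr : 0 < s → rho A B (s + l) ≤ rho A B s * Real.exp c)
    (hl' : s < 1 → rho A B (s - l) ≤ rho A B s * Real.exp c) :
    rho A B s * Real.exp (-δ) * (1 - 2 * Real.exp (c - l * δ)) ≤ ∑ x, min (A x) (B x) := by
  -- At `s = 0` a large positive ratio costs nothing, because the tilted weight is `A` itself;
  -- likewise a large negative ratio at `s = 1`. The switches `i`, `j` drop these tails.
  set i : ℝ := if 0 < s then 1 else 0 with hi
  set j : ℝ := if s < 1 then 1 else 0 with hj
  have hi0 : 0 ≤ i := by rw [hi]; split_ifs <;> norm_num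
  have hj0 : 0 ≤ j := by rw [hj]; split_ifs <;> norm_num
  -- The last factor is an exponential minorant of the indicator that the ratio lies within `δ` on
  -- the sides that count. Summed against the tilted weights, it produces `rho` at `s + l` and `s -
  -- l`.
  have pointwise : ∀ x, common A B x * Real.exp (s * logRatio A B x) * Real.exp (-δ) *
      (1 - i * Real.exp (l * (logRatio A B x - δ)) - j * Real.exp (l * (-logRatio A B x - δ)))
      ≤ min (A x) (B x) := fun x => by
    unfold common logRatio
    split_ifs with h
    · have ha := (hA x).lt_of_ne' h.1
      have hb := (hB x).lt_of_ne' h.2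
      set D := Real.log (B x / A x) with hD
      have hBx : B x = A x * Real.exp D := by
        rw [hD, Real.exp_log (div_pos hb ha)]; field_simp
      have hmin : 0 ≤ min (A x) (B x) := le_min ha.le hb.le
      have hpre : 0 ≤ A x * Real.exp (s * D) * Real.exp (-δ) := by positivity
      have e1 := Real.exp_pos (l * (D - δ))
      have e2 := Real.exp_pos (l * (-D - δ))
      by_cases h1 : 0 < s ∧ δ < D
      · refine le_trans (mul_nonpos_of_nonneg_of_nonpos hpre ?_) hmin
        have : 1 ≤ Real.exp (l * (D - δ)) :=
          Real.one_le_exp (mul_nonneg hl (by linarith [h1.2]))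
        have h2 : i = 1 := by rw [hi, if_pos h1.1]
        rw [h2]
        nlinarith [mul_nonneg hj0 e2.le]
      by_cases h2 : s < 1 ∧ δ < -D
      · refine le_trans (mul_nonpos_of_nonneg_of_nonpos hpre ?_) hmin
        have : 1 ≤ Real.exp (l * (-D - δ)) :=
          Real.one_le_exp (mul_nonneg hl (by linarith [h2.2]))
        have h3 : j = 1 := by rw [hj, if_pos h2.1]
        rw [h3]
        nlinarith [mul_nonneg hi0 e1.le]
      refine (mul_le_of_le_one_right hpre ?_).trans ?_
      · nlinarith [mul_nonneg hi0 e1.le, mul_nonneg hj0 e2.le]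
      have g1 : s * D ≤ δ := by
        rcases hs.1.eq_or_lt with h0 | h0
        · rw [← h0, zero_mul]; exact hδ
        · have : D ≤ δ := not_lt.1 fun h' => h1 ⟨h0, h'⟩
          nlinarith [hs.2]
      have g2 : -((1 - s) * D) ≤ δ := by
        rcases hs.2.eq_or_lt with h0 | h0
        · rw [h0]; simpa using hδ
        · have : -D ≤ δ := not_lt.1 fun h' => h2 ⟨h0, h'⟩
          nlinarith [hs.1]
      rw [mul_assoc, ← Real.exp_add]
      refine le_min ?_ ?_
      · refine mul_le_of_le_one_right ha.le (Real.exp_le_one_iff.2 ?_)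
        linarith
      · rw [hBx]
        gcongr
        linarith
    · rw [zero_mul, zero_mul, zero_mul]
      exact le_min (hA x) (hB x)
  have hi' : i * rho A B (s + l) ≤ rho A B s * Real.exp c := by
    rw [hi]
    split_ifs with h
    · rw [one_mul]; exact hr h
    · rw [zero_mul]; exact mul_nonneg (rho_nonneg hA hB s) (Real.exp_pos _).le
  have hj' : j * rho A B (s - l) ≤ rho A B s * Real.exp c := by
    rw [hj]
    split_ifs with h
    · rw [one_mul]; exact hl' h
    · rw [zero_mul]; exact mul_nonneg (rho_nonneg hA hB s) (Real.exp_pos _).le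
  refine le_trans ?_ (Finset.sum_le_sum fun x _ => pointwise x)
  have hsum : ∑ x, common A B x * Real.exp (s * logRatio A B x) * Real.exp (-δ) *
      (1 - i * Real.exp (l * (logRatio A B x - δ)) - j * Real.exp (l * (-logRatio A B x - δ)))
      = Real.exp (-δ) * (rho A B s - Real.exp (-(l * δ)) * (i * rho A B (s + l))
        - Real.exp (-(l * δ)) * (j * rho A B (s - l))) := by
    simp only [rho_eq_sum_exp hA hB, Finset.mul_sum]
    rw [← Finset.sum_sub_distrib, ← Finset.sum_sub_distrib, Finset.mul_sum]
    refine Finset.sum_congr rfl fun x _ => ?_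
    have e1 : Real.exp (l * (logRatio A B x - δ)) =
        Real.exp (-(l * δ)) * Real.exp (l * logRatio A B x) := by
      rw [← Real.exp_add]; congr 1; ring
    have e2 : Real.exp (l * (-logRatio A B x - δ)) =
        Real.exp (-(l * δ)) * Real.exp (-(l * logRatio A B x)) := by
      rw [← Real.exp_add]; congr 1; ring
    rw [e1, e2, add_mul, sub_mul, sub_eq_add_neg (s * _), Real.exp_add, Real.exp_add]
    ring
  rw [hsum, mul_comm (rho A B s), mul_assoc, sub_eq_add_neg c, Real.exp_add]
  gcongr
  have e := (Real.exp_pos (-(l * δ))).le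
  nlinarith [mul_le_mul_of_nonneg_left hi' e, mul_le_mul_of_nonneg_left hj' e]

end FiniteMeasures

/-! ### Second-order control of `log rho`, stable under products. -/

/-- `r` is differentiable at `s` with logarithmic derivative `q`, and grows from `s` at most like
`exp (l * q + l ^ 2 * K)` for `|l| * M ≤ 1`. -/
def LogTaylor (M : ℝ) (r : ℝ → ℝ) (s q K : ℝ) : Prop :=
  HasDerivAt r (r s * q) s ∧ ∀ l, |l| * M ≤ 1 → r (s + l) ≤ r s * Real.exp (l * q + l ^ 2 * K)

theorem LogTaylor.one (M s : ℝ) : LogTaylor M (fun _ => 1) s 0 0 := by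
  refine ⟨by simpa using hasDerivAt_const s (1 : ℝ), fun l _ => by simp⟩

theorem LogTaylor.mul {M s q q' K K' : ℝ} {r r' : ℝ → ℝ} (hr : ∀ t, 0 ≤ r t)
    (hr' : ∀ t, 0 ≤ r' t) (h : LogTaylor M r s q K) (h' : LogTaylor M r' s q' K') :
    LogTaylor M (fun t => r t * r' t) s (q + q') (K + K') := by
  refine ⟨(h.1.mul h'.1).congr_deriv (by ring), fun l hl => ?_⟩
  refine (mul_le_mul (h.2 l hl) (h'.2 l hl) (hr' _)
    (mul_nonneg (hr _) (Real.exp_pos _).le)).trans (le_of_eq ?_)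
  rw [mul_mul_mul_comm, ← Real.exp_add]
  congr 2
  ring

theorem LogTaylor.prod {ι : Type*} {M s K : ℝ} {r : ι → ℝ → ℝ} (hr : ∀ i t, 0 ≤ r i t)
    (h : ∀ i, ∃ q, LogTaylor M (r i) s q K) (S : Finset ι) :
    ∃ q, LogTaylor M (fun t => ∏ i ∈ S, r i t) s q (S.card * K) := by
  classical
  induction S using Finset.induction_on with
  | empty => exact ⟨0, by simpa using LogTaylor.one M s⟩
  | insert i S hi ih =>
    obtain ⟨q, hq⟩ := ih
    obtain ⟨q', hq'⟩ := h i
    refine ⟨q' + q, ?_⟩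
    have := LogTaylor.mul (hr i) (fun t => Finset.prod_nonneg fun j _ => hr j t) hq' hq
    simp only [Finset.prod_insert hi]
    convert this using 1
    rw [Finset.card_insert_of_notMem hi]
    push_cast
    ring

/-- Apply `exp x ≤ 1 + x + x^2` for `|x| ≤ 1` termwise, then `1 + y ≤ exp y` to the sum. -/
theorem logTaylor_rho {Ω : Type*} [Fintype Ω] {A B : Ω → ℝ} (hA : ∀ x, 0 ≤ A x)
    (hB : ∀ x, 0 ≤ B x) {M : ℝ} (hM : ∀ x, |logRatio A B x| ≤ M) (s : ℝ) :
    ∃ q, LogTaylor M (rho A B) s q (M ^ 2) := by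
  set d := ∑ x, common A B x * (Real.exp (s * logRatio A B x) * logRatio A B x) with hd
  have hderiv : HasDerivAt (rho A B) d s := by
    have : rho A B = fun s => ∑ x, common A B x * Real.exp (s * logRatio A B x) :=
      funext fun s => rho_eq_sum_exp hA hB s
    rw [this]
    refine HasDerivAt.fun_sum fun x _ => ?_
    simpa using (((hasDerivAt_id s).mul_const (logRatio A B x)).exp).const_mul (common A B x)
  rcases eq_or_ne (rho A B s) 0 with h0 | h0
  · have hz := rho_eq_zero_of_eq_zero hA hB h0
    have : rho A B = fun _ => 0 := funext hz
    refine ⟨0, ?_, fun l _ => by simp [this]⟩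
    rw [this]
    simpa using hasDerivAt_const s (0 : ℝ)
  refine ⟨d / rho A B s, ?_, fun l hl => ?_⟩
  · rwa [mul_div_cancel₀ _ h0]
  have hpos := (rho_nonneg hA hB s).lt_of_ne' h0
  have hbound : ∀ x, Real.exp (l * logRatio A B x) ≤
      1 + l * logRatio A B x + l ^ 2 * M ^ 2 := fun x => by
    have hx : |l * logRatio A B x| ≤ |l| * M := by
      rw [abs_mul]; exact mul_le_mul_of_nonneg_left (hM x) (abs_nonneg l)
    have h1 := (abs_le.1 (Real.abs_exp_sub_one_sub_id_le (hx.trans hl))).2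
    have h2 : (l * logRatio A B x) ^ 2 ≤ (|l| * M) ^ 2 := by
      rw [← sq_abs (l * _)]; exact pow_le_pow_left₀ (abs_nonneg _) hx 2
    rw [mul_pow |l|, sq_abs] at h2
    linarith
  calc rho A B (s + l)
      ≤ ∑ x, (common A B x * Real.exp (s * logRatio A B x) +
        l * (common A B x * (Real.exp (s * logRatio A B x) * logRatio A B x)) +
        l ^ 2 * M ^ 2 * (common A B x * Real.exp (s * logRatio A B x))) := by
        rw [rho_eq_sum_exp hA hB]
        refine Finset.sum_le_sum fun x _ => ?_
        rw [add_mul, Real.exp_add, ← mul_assoc]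
        refine (mul_le_mul_of_nonneg_left (hbound x)
          (mul_nonneg (common_nonneg hA x) (Real.exp_pos _).le)).trans (le_of_eq ?_)
        ring
    _ = rho A B s * (l * (d / rho A B s) + l ^ 2 * M ^ 2 + 1) := by
        rw [Finset.sum_add_distrib, Finset.sum_add_distrib, ← Finset.mul_sum, ← Finset.mul_sum,
          ← rho_eq_sum_exp hA hB, ← hd]
        field_simp
        ring
    _ ≤ _ := mul_le_mul_of_nonneg_left (Real.add_one_le_exp _) hpos.le

/-- At a minimizer over `[0, 1]` of `r`, moving away in the directions that stay inside `[0, 1]`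
changes `log r` by a second-order term at most. -/
theorem LogTaylor.le_of_isMinOn {M s q K l : ℝ} {r : ℝ → ℝ} (h : LogTaylor M r s q K)
    (hs : s ∈ Icc (0 : ℝ) 1) (hmin : IsMinOn r (Icc 0 1) s) (hpos : 0 < r s) (hl : 0 ≤ l)
    (hlM : l * M ≤ 1) :
    (0 < s → r (s + l) ≤ r s * Real.exp (l ^ 2 * K)) ∧
      (s < 1 → r (s - l) ≤ r s * Real.exp (l ^ 2 * K)) := by
  -- First-order optimality. At an interior point it forces `q = 0`; at an endpoint it fixes only
  -- the sign of `q`, which controls the step leaving the interval.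
  have tangent : ∀ t ∈ Icc (0 : ℝ) 1, 0 ≤ (t - s) * q := fun t ht => by
    have := hmin.localize.hasFDerivWithinAt_nonneg h.1.hasFDerivAt.hasFDerivWithinAt
      (sub_mem_posTangentConeAt_of_segment_subset ((convex_Icc 0 1).segment_subset hs ht))
    simp only [ContinuousLinearMap.toSpanSingleton_apply, smul_eq_mul] at this
    nlinarith
  refine ⟨fun h0 => ?_, fun h1 => ?_⟩
  · have hq : q ≤ 0 := by nlinarith [tangent 0 ⟨le_rfl, zero_le_one⟩]
    refine (h.2 l (by rwa [abs_of_nonneg hl])).trans ?_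
    gcongr
    nlinarith
  · have hq : 0 ≤ q := by nlinarith [tangent 1 ⟨zero_le_one, le_rfl⟩]
    refine (h.2 (-l) (by rwa [abs_neg, abs_of_nonneg hl])).trans ?_
    gcongr
    nlinarith

/-! ### Multiplicativity of `rho` over independent uses. -/

theorem rho_tensor {Ω Ω' : Type*} [Fintype Ω] [Fintype Ω'] {A B : Ω → ℝ} {A' B' : Ω' → ℝ}
    (hA : ∀ x, 0 ≤ A x) (hB : ∀ x, 0 ≤ B x) (hA' : ∀ x, 0 ≤ A' x) (hB' : ∀ x, 0 ≤ B' x)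
    (s : ℝ) :
    rho (fun w : Ω × Ω' => A w.1 * A' w.2) (fun w => B w.1 * B' w.2) s =
      rho A B s * rho A' B' s := by
  unfold rho
  rw [Finset.sum_mul_sum, Fintype.sum_prod_type]
  refine Finset.sum_congr rfl fun x _ => Finset.sum_congr rfl fun y _ => ?_
  simp only [Real.mul_rpow (hA x) (hA' y), Real.mul_rpow (hB x) (hB' y)]
  by_cases h1 : A x = 0 <;> by_cases h2 : B x = 0 <;> by_cases h3 : A' y = 0 <;>
    by_cases h4 : B' y = 0 <;> simp [h1, h2, h3, h4, mul_mul_mul_comm]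

theorem rho_prod {ι Y : Type*} [Fintype ι] [DecidableEq ι] [Fintype Y] {A B : ι → Y → ℝ}
    (hA : ∀ i x, 0 ≤ A i x) (hB : ∀ i x, 0 ≤ B i x) (s : ℝ) :
    rho (fun y : ι → Y => ∏ i, A i (y i)) (fun y => ∏ i, B i (y i)) s =
      ∏ i, rho (A i) (B i) s := by
  classical
  unfold rho
  rw [Finset.prod_univ_sum, Fintype.piFinset_univ]
  refine Finset.sum_congr rfl fun y _ => ?_
  rw [Fintype.prod_ite_zero, Finset.prod_mul_distrib,
    Real.finsetProd_rpow _ _ fun i _ => hA i (y i),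
    Real.finsetProd_rpow _ _ fun i _ => hB i (y i)]
  simp only [ne_eq, Finset.prod_eq_zero_iff, Finset.mem_univ, true_and, not_exists, forall_and]

/-! ### Error probabilities of codes. -/

section Channels

variable {Y Z : Type*} [Fintype Y] [Fintype Z]

/-- The probability of the output `w` when the pair of words `x` is sent through `P` and `Q`. -/
def pairProb (P : BinaryDMC Y) (Q : BinaryDMC Z) {a b : ℕ}
    (x : (Fin a → Fin 2) × (Fin b → Fin 2)) (w : (Fin a → Y) × (Fin b → Z)) : ℝ :=
  wordProb P x.1 w.1 * wordProb Q x.2 w.2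

theorem wordProb_nonneg (W : BinaryDMC Y) {k : ℕ} (x : Fin k → Fin 2) (y : Fin k → Y) :
    0 ≤ wordProb W x y :=
  Finset.prod_nonneg fun i _ => W.prob_nonneg (x i) (y i)

theorem pairProb_nonneg (P : BinaryDMC Y) (Q : BinaryDMC Z) {a b : ℕ}
    (x : (Fin a → Fin 2) × (Fin b → Fin 2)) (w : (Fin a → Y) × (Fin b → Z)) :
    0 ≤ pairProb P Q x w :=
  mul_nonneg (wordProb_nonneg P _ _) (wordProb_nonneg Q _ _)

theorem errorProb_eq (P : BinaryDMC Y) (Q : BinaryDMC Z) {a b : ℕ} (c : Code Y Z a b) :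
    errorProb P Q c = 1 / 2 * ∑ w, ((if c.dec w ≠ 0 then pairProb P Q (c.enc 0) w else 0) +
      if c.dec w ≠ 1 then pairProb P Q (c.enc 1) w else 0) := by
  unfold errorProb pairProb
  simp only [Fin.sum_univ_two, Finset.sum_add_distrib, Fintype.sum_prod_type, mul_add]

/-- Whatever a decoder answers at `w`, it loses the probability of `w` under the other message. -/
theorem le_errorProb (P : BinaryDMC Y) (Q : BinaryDMC Z) {a b : ℕ} (c : Code Y Z a b) :
    1 / 2 * ∑ w, min (pairProb P Q (c.enc 0) w) (pairProb P Q (c.enc 1) w) ≤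
      errorProb P Q c := by
  rw [errorProb_eq]
  gcongr with w
  rcases (by omega : c.dec w = 0 ∨ c.dec w = 1) with h | h <;> simp [h]

theorem errorProb_nonneg (P : BinaryDMC Y) (Q : BinaryDMC Z) {a b : ℕ} (c : Code Y Z a b) :
    0 ≤ errorProb P Q c :=
  le_trans (mul_nonneg (by norm_num) (Finset.sum_nonneg fun w _ =>
    le_min (pairProb_nonneg P Q _ w) (pairProb_nonneg P Q _ w))) (le_errorProb P Q c)

instance (Y Z : Type*) (a b : ℕ) : Nonempty (Code Y Z a b) := ⟨⟨fun _ => (0, 0), fun _ => 0⟩⟩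

theorem minErrorProb_nonneg (P : BinaryDMC Y) (Q : BinaryDMC Z) (a b : ℕ) :
    0 ≤ minErrorProb P Q a b :=
  le_ciInf fun c => errorProb_nonneg P Q c

/-- Maximum likelihood decoding loses exactly the smaller probability at each output. -/
theorem minErrorProb_le (P : BinaryDMC Y) (Q : BinaryDMC Z) {a b : ℕ}
    (x x' : (Fin a → Fin 2) × (Fin b → Fin 2)) :
    minErrorProb P Q a b ≤ 1 / 2 * ∑ w, min (pairProb P Q x w) (pairProb P Q x' w) := by
  classical
  refine (ciInf_le ⟨0, ?_⟩ ⟨fun θ => if θ = 0 then x else x',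
    fun w => if pairProb P Q x w ≤ pairProb P Q x' w then 1 else 0⟩).trans (le_of_eq ?_)
  · rintro _ ⟨c, rfl⟩
    exact errorProb_nonneg P Q c
  · rw [errorProb_eq]
    congr 1
    refine Finset.sum_congr rfl fun w _ => ?_
    by_cases h : pairProb P Q x w ≤ pairProb P Q x' w
    · simp [h]
    · simp [h, le_of_not_ge h]

theorem rho_pairProb (P : BinaryDMC Y) (Q : BinaryDMC Z) {a b : ℕ}
    (x x' : (Fin a → Fin 2) × (Fin b → Fin 2)) (s : ℝ) :
    rho (pairProb P Q x) (pairProb P Q x') s =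
      (∏ i, rho (P.prob (x.1 i)) (P.prob (x'.1 i)) s) *
        ∏ i, rho (Q.prob (x.2 i)) (Q.prob (x'.2 i)) s := by
  rw [← rho_prod (fun i => P.prob_nonneg _) (fun i => P.prob_nonneg _),
    ← rho_prod (fun i => Q.prob_nonneg _) (fun i => Q.prob_nonneg _)]
  exact rho_tensor (wordProb_nonneg P _) (wordProb_nonneg P _) (wordProb_nonneg Q _)
    (wordProb_nonneg Q _) s

/-- `ρ(W(·|0), W(·|1), s)`. -/
def rhoCh (W : BinaryDMC Y) (s : ℝ) : ℝ := rho (W.prob 0) (W.prob 1) s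

theorem rhoCh_nonneg (W : BinaryDMC Y) (s : ℝ) : 0 ≤ rhoCh W s :=
  rho_nonneg (W.prob_nonneg 0) (W.prob_nonneg 1) s

theorem rhoCh_le_one (W : BinaryDMC Y) {s : ℝ} (hs : s ∈ Icc (0 : ℝ) 1) : rhoCh W s ≤ 1 :=
  rho_le_one (W.prob_nonneg 0) (W.prob_nonneg 1) (W.sum_prob 0) (W.sum_prob 1) hs

/-- The error probability of the code with constant codewords and maximum likelihood decoding. -/
theorem minErrorProb_le_rhoCh (P : BinaryDMC Y) (Q : BinaryDMC Z) (a b : ℕ) {s : ℝ}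
    (hs : s ∈ Icc (0 : ℝ) 1) : minErrorProb P Q a b ≤ rhoCh P s ^ a * rhoCh Q s ^ b := by
  refine (minErrorProb_le P Q (fun _ => 0, fun _ => 0) (fun _ => 1, fun _ => 1)).trans ?_
  have h := sum_min_le_rho (pairProb_nonneg P Q ((fun _ => 0, fun _ => 0) :
    (Fin a → Fin 2) × (Fin b → Fin 2))) (pairProb_nonneg P Q (fun _ => 1, fun _ => 1)) hs
  rw [rho_pairProb] at h
  simp only [Finset.prod_const, Finset.card_univ, Fintype.card_fin] at h
  have h0 : 0 ≤ rhoCh P s ^ a * rhoCh Q s ^ b :=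
    mul_nonneg (pow_nonneg (rhoCh_nonneg P s) a) (pow_nonneg (rhoCh_nonneg Q s) b)
  unfold rhoCh at h0 ⊢
  linarith

/-- Only finitely many values occur. Where a probability vanishes the quotient is `0` and `Real.log
0 = 0`, so the default value is harmless. -/
theorem exists_logRatio_le (W : BinaryDMC Y) :
    ∃ M, ∀ i j y, |logRatio (W.prob i) (W.prob j) y| ≤ M := by
  obtain ⟨M, hM⟩ := (Set.finite_range fun p : Fin 2 × Fin 2 × Y =>
    |logRatio (W.prob p.1) (W.prob p.2.1) p.2.2|).bddAbove
  exact ⟨M, fun i j y => hM ⟨(i, j, y), rfl⟩⟩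

/-- `μ_W(s) ≤ μ_W(1 - s)` for `s ∈ [0, 1/2]`, in terms of `ρ`. -/
def Flip (W : BinaryDMC Y) : Prop := ∀ s ∈ Icc (0 : ℝ) (1 / 2), rhoCh W s ≤ rhoCh W (1 - s)

/-- No letter pair has a smaller `ρ` at `s` than the pair `(0, 1)` at `min s (1 - s)`. -/
theorem Flip.rhoCh_min_le {W : BinaryDMC Y} (h : Flip W) (i j : Fin 2) {s : ℝ}
    (hs : s ∈ Icc (0 : ℝ) 1) : rhoCh W (min s (1 - s)) ≤ rho (W.prob i) (W.prob j) s := by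
  have hs' : 1 - s ∈ Icc (0 : ℝ) 1 := ⟨by linarith [hs.2], by linarith [hs.1]⟩
  have key : rhoCh W (min s (1 - s)) ≤ rhoCh W s ∧
      rhoCh W (min s (1 - s)) ≤ rhoCh W (1 - s) := by
    rcases le_total s (1 - s) with h1 | h1
    · rw [min_eq_left h1]
      exact ⟨le_rfl, h s ⟨hs.1, by linarith⟩⟩
    · rw [min_eq_right h1]
      have := h (1 - s) ⟨hs'.1, by linarith⟩
      rw [sub_sub_cancel] at this
      exact ⟨this, le_rfl⟩
  have h1 : rhoCh W (min s (1 - s)) ≤ 1 := key.1.trans (rhoCh_le_one W hs)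
  by_cases hij : i = j
  · rw [hij, rho_self (W.prob_nonneg j) (W.sum_prob j)]
    exact h1
  · rcases (by omega : i = 0 ∧ j = 1 ∨ i = 1 ∧ j = 0) with ⟨rfl, rfl⟩ | ⟨rfl, rfl⟩
    · exact key.1
    · rw [rho_swap]
      exact key.2

/-- Converse bound: no code with `a` uses of `P` and `b` uses of `Q` has an error probability much
smaller than `min_s ρ_P(s)^a ρ_Q(s)^b`. -/
theorem exists_le_minErrorProb {P : BinaryDMC Y} {Q : BinaryDMC Z} (hP : Flip P) (hQ : Flip Q) :
    ∃ M : ℝ, 0 < M ∧ ∀ (a b : ℕ) (β l δ : ℝ), 0 < β → 0 ≤ l → l * M ≤ 1 → 0 ≤ δ →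
      (∀ s ∈ Icc (0 : ℝ) 1, β ≤ rhoCh P s ^ a * rhoCh Q s ^ b) →
      2 * Real.exp (l ^ 2 * ((a + b : ℕ) * M ^ 2) - l * δ) ≤ 1 →
      1 / 2 * (β * Real.exp (-δ) * (1 - 2 * Real.exp (l ^ 2 * ((a + b : ℕ) * M ^ 2) - l * δ))) ≤
        minErrorProb P Q a b := by
  obtain ⟨M₁, hM₁⟩ := exists_logRatio_le P
  obtain ⟨M₂, hM₂⟩ := exists_logRatio_le Q
  set M := max 1 (max M₁ M₂) with hMdef
  refine ⟨M, lt_of_lt_of_le one_pos (le_max_left _ _), ?_⟩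
  intro a b β l δ hβ hl hlM hδ hmin he
  have hP1 : ∀ i j y, |logRatio (P.prob i) (P.prob j) y| ≤ M := fun i j y =>
    (hM₁ i j y).trans ((le_max_left _ _).trans (le_max_right _ _))
  have hQ1 : ∀ i j y, |logRatio (Q.prob i) (Q.prob j) y| ≤ M := fun i j y =>
    (hM₂ i j y).trans ((le_max_right _ _).trans (le_max_right _ _))
  refine le_ciInf fun c => le_trans ?_ (le_errorProb P Q c)
  set A := pairProb P Q (c.enc 0)
  set B := pairProb P Q (c.enc 1)
  have hA : ∀ w, 0 ≤ A w := pairProb_nonneg P Q _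
  have hB : ∀ w, 0 ≤ B w := pairProb_nonneg P Q _
  obtain ⟨s, hs, hsmin⟩ := isCompact_Icc.exists_isMinOn ⟨(0 : ℝ), left_mem_Icc.2 zero_le_one⟩
    (continuous_rho A B).continuousOn
  -- Factor by factor, the code's `rho` at `s` dominates that of the constant codewords at `min s (1
  -- - s)`, where the hypothesis on `β` applies.
  have hβs : β ≤ rho A B s := by
    have hs' : min s (1 - s) ∈ Icc (0 : ℝ) 1 :=
      ⟨le_min hs.1 (by linarith [hs.2]), (min_le_left _ _).trans hs.2⟩
    refine (hmin _ hs').trans ?_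
    rw [rho_pairProb]
    refine mul_le_mul ?_ ?_ (pow_nonneg (rhoCh_nonneg Q _) b)
      (Finset.prod_nonneg fun i _ => rho_nonneg (P.prob_nonneg _) (P.prob_nonneg _) _)
    · have := Finset.prod_le_prod (s := Finset.univ) (fun i _ => rhoCh_nonneg P (min s (1 - s)))
        (fun i _ => hP.rhoCh_min_le ((c.enc 0).1 i) ((c.enc 1).1 i) hs)
      simpa using this
    · have := Finset.prod_le_prod (s := Finset.univ) (fun i _ => rhoCh_nonneg Q (min s (1 - s)))
        (fun i _ => hQ.rhoCh_min_le ((c.enc 0).2 i) ((c.enc 1).2 i) hs)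
      simpa using this
  obtain ⟨q₁, hq₁⟩ := LogTaylor.prod (S := Finset.univ) (M := M) (s := s) (K := M ^ 2)
    (r := fun i t => rho (P.prob ((c.enc 0).1 i)) (P.prob ((c.enc 1).1 i)) t)
    (fun i t => rho_nonneg (P.prob_nonneg _) (P.prob_nonneg _) t)
    (fun i => logTaylor_rho (P.prob_nonneg _) (P.prob_nonneg _) (hP1 _ _) s)
  obtain ⟨q₂, hq₂⟩ := LogTaylor.prod (S := Finset.univ) (M := M) (s := s) (K := M ^ 2)
    (r := fun i t => rho (Q.prob ((c.enc 0).2 i)) (Q.prob ((c.enc 1).2 i)) t)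
    (fun i t => rho_nonneg (Q.prob_nonneg _) (Q.prob_nonneg _) t)
    (fun i => logTaylor_rho (Q.prob_nonneg _) (Q.prob_nonneg _) (hQ1 _ _) s)
  have hq := LogTaylor.mul
    (fun t => Finset.prod_nonneg fun i _ => rho_nonneg (P.prob_nonneg _) (P.prob_nonneg _) t)
    (fun t => Finset.prod_nonneg fun i _ => rho_nonneg (Q.prob_nonneg _) (Q.prob_nonneg _) t)
    hq₁ hq₂
  simp only [← rho_pairProb] at hq
  obtain ⟨hr, hl'⟩ := hq.le_of_isMinOn hs hsmin (hβ.trans_le hβs) hl hlM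
  have hK : ((Finset.univ : Finset (Fin a)).card * M ^ 2 +
      (Finset.univ : Finset (Fin b)).card * M ^ 2 : ℝ) = (a + b : ℕ) * M ^ 2 := by
    simp only [Finset.card_univ, Fintype.card_fin]
    push_cast
    ring
  rw [hK] at hr hl'
  -- Lowering `rho A B s` to `β` requires the last factor to be nonnegative, which is what `he`
  -- provides.
  refine le_trans ?_ (mul_le_mul_of_nonneg_left (le_sum_min hA hB hs hl hδ hr hl')
    (by norm_num))
  gcongr

end Channels

/-! ### Existence and value of the limiting exponents. -/

section Exponents

variable {Y Z : Type*} [Fintype Y] [Fintype Z]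

theorem tendsto_exp_neg_natCast_mul {κ : ℝ} (hκ : 0 < κ) :
    Tendsto (fun n : ℕ => Real.exp (-(n * κ))) atTop (𝓝 0) :=
  Real.tendsto_exp_neg_atTop_nhds_zero.comp (tendsto_natCast_atTop_atTop.atTop_mul_const hκ)

theorem floor_mul_le {γ : ℝ} (hγ : γ ∈ Icc (0 : ℝ) 1) (n : ℕ) : ⌊γ * n⌋₊ ≤ n :=
  Nat.floor_le_of_le (mul_le_of_le_one_left n.cast_nonneg hγ.2)

/-- The functions `u`, `v` stand for `log ρ_P`, `log ρ_Q`, but are tied to them only through the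
powers that occur. A channel that is never used can thus be given the function `0`, even if its `ρ`
vanishes. -/
theorem eventually_exp_bounds {P : BinaryDMC Y} {Q : BinaryDMC Z} (hP : Flip P) (hQ : Flip Q)
    {γ : ℝ} (hγ : γ ∈ Icc (0 : ℝ) 1) {u v : ℝ → ℝ} (hu : ContinuousOn u (Icc 0 1))
    (hv : ContinuousOn v (Icc 0 1))
    (hPu : ∀ (n : ℕ), ∀ s ∈ Icc (0 : ℝ) 1,
      rhoCh P s ^ ⌊γ * n⌋₊ = Real.exp (⌊γ * n⌋₊ * u s))
    (hQv : ∀ (n : ℕ), ∀ s ∈ Icc (0 : ℝ) 1,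
      rhoCh Q s ^ (n - ⌊γ * n⌋₊) = Real.exp ((n - ⌊γ * n⌋₊ : ℕ) * v s))
    {s₀ : ℝ} (hs₀ : s₀ ∈ Icc (0 : ℝ) 1)
    (hmin : IsMinOn (fun s => γ * u s + (1 - γ) * v s) (Icc 0 1) s₀) {ε : ℝ} (hε : 0 < ε) :
    ∀ᶠ n : ℕ in atTop,
      Real.exp (n * (γ * u s₀ + (1 - γ) * v s₀ - ε)) ≤
          minErrorProb P Q ⌊γ * n⌋₊ (n - ⌊γ * n⌋₊) ∧
        minErrorProb P Q ⌊γ * n⌋₊ (n - ⌊γ * n⌋₊) ≤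
          Real.exp (n * (γ * u s₀ + (1 - γ) * v s₀ + ε)) := by
  obtain ⟨M, hM, hlow⟩ := exists_le_minErrorProb hP hQ
  obtain ⟨C, hC⟩ := isCompact_Icc.exists_bound_of_continuousOn (hu.sub hv)
  simp only [Real.norm_eq_abs] at hC
  set I := γ * u s₀ + (1 - γ) * v s₀ with hI
  have hC0 : 0 ≤ C := (abs_nonneg _).trans (hC s₀ hs₀)
  have hfloor : ∀ᶠ n : ℕ in atTop, |(⌊γ * n⌋₊ : ℝ) / n - γ| < ε / (4 * (C + 1)) := by
    have := (tendsto_nat_floor_mul_div_atTop hγ.1).comp (tendsto_natCast_atTop_atTop (R := ℝ))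
    exact (Metric.tendsto_nhds.1 this _ (by positivity))
  -- With `δ = n * (ε / 4)`, this choice gives `l^2 * n * M^2 - l * δ ≤ -n * l * ε / 8`, so the
  -- discarded tails are eventually negligible. The loss `ε` splits into `ε / 4` for rounding `γ *
  -- n`, `ε / 4` for `δ` and `ε / 2` for the constant factor `1 / 4`.
  set l := min (1 / M) (ε / (8 * M ^ 2)) with hl
  have hl0 : 0 < l := lt_min (by positivity) (by positivity)
  have hlM : l * M ≤ 1 := by
    calc l * M ≤ 1 / M * M := by gcongr; exact min_le_left _ _
      _ = 1 := by field_simp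
  have hlM2 : l * M ^ 2 ≤ ε / 8 := by
    calc l * M ^ 2 ≤ ε / (8 * M ^ 2) * M ^ 2 := by gcongr; exact min_le_right _ _
      _ = ε / 8 := by field_simp
  have hexp1 : ∀ᶠ n : ℕ in atTop, Real.exp (-(n * (l * (ε / 8)))) < 1 / 4 :=
    (tendsto_exp_neg_natCast_mul (by positivity)).eventually_lt_const (by norm_num)
  have hexp2 : ∀ᶠ n : ℕ in atTop, Real.exp (-(n * (ε / 2))) < 1 / 4 :=
    (tendsto_exp_neg_natCast_mul (by positivity)).eventually_lt_const (by norm_num)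
  filter_upwards [hfloor, hexp1, hexp2, eventually_gt_atTop 0] with n h1 h2 h3 hn
  have hn0 : (0 : ℝ) < n := Nat.cast_pos.2 hn
  set a := ⌊γ * n⌋₊ with ha
  have hab : a + (n - a) = n := Nat.add_sub_cancel' (floor_mul_le hγ n)
  have hsum : ∀ s, (a : ℝ) * u s + (n - a : ℕ) * v s =
      n * (γ * u s + (1 - γ) * v s + ((a : ℝ) / n - γ) * (u s - v s)) := fun s => by
    rw [Nat.cast_sub (floor_mul_le hγ n), ← ha]
    field_simp
    ring
  have hdiff : ∀ s ∈ Icc (0 : ℝ) 1, |((a : ℝ) / n - γ) * (u s - v s)| ≤ ε / 4 := fun s hs => by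
    rw [abs_mul]
    calc |(a : ℝ) / n - γ| * |u s - v s| ≤ ε / (4 * (C + 1)) * (C + 1) := by
          gcongr
          exact (hC s hs).trans (by linarith)
      _ = ε / 4 := by field_simp
  have hprod : ∀ s ∈ Icc (0 : ℝ) 1, rhoCh P s ^ a * rhoCh Q s ^ (n - a) =
      Real.exp (n * (γ * u s + (1 - γ) * v s + ((a : ℝ) / n - γ) * (u s - v s))) := fun s hs => by
    rw [← hsum, Real.exp_add, hPu n s hs, hQv n s hs]
  constructor
  · have he : Real.exp (l ^ 2 * ((a + (n - a) : ℕ) * M ^ 2) - l * (n * (ε / 4))) ≤ 1 / 4 := by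
      refine le_trans (Real.exp_le_exp.2 ?_) h2.le
      rw [hab]
      have : l * n * (l * M ^ 2) ≤ l * n * (ε / 8) := by gcongr
      nlinarith
    have := hlow a (n - a) (Real.exp (n * (I - ε / 4))) l (n * (ε / 4)) (Real.exp_pos _) hl0.le hlM
      (by positivity) (fun s hs => ?_) (by linarith)
    · refine le_trans ?_ this
      have e1 : Real.exp (n * (I - ε)) = Real.exp (n * (I - ε / 4)) * Real.exp (-(n * (ε / 4))) *
          Real.exp (-(n * (ε / 2))) := by
        rw [← Real.exp_add, ← Real.exp_add]; congr 1; ring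
      rw [e1]
      have e2 : 0 < Real.exp (n * (I - ε / 4)) * Real.exp (-(n * (ε / 4))) := by positivity
      nlinarith
    · rw [hprod s hs]
      have := hmin hs
      simp only [mem_ofPred_eq] at this
      gcongr
      linarith [(abs_le.1 (hdiff s hs)).1]
  · refine (minErrorProb_le_rhoCh P Q a (n - a) hs₀).trans ?_
    rw [hprod s₀ hs₀, ← hI]
    gcongr
    linarith [(abs_le.1 (hdiff s₀ hs₀)).2]

theorem extLog_of_pos {r : ℝ} (hr : 0 < r) : extLog r = (Real.log r : EReal) :=
  ENNReal.log_ofReal_of_pos hr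

theorem extLog_of_nonpos {r : ℝ} (hr : r ≤ 0) : extLog r = ⊥ := by
  unfold extLog
  rw [ENNReal.ofReal_of_nonpos hr, ENNReal.log_zero]

theorem extLog_mono : Monotone extLog := fun _ _ h =>
  ENNReal.log_monotone (ENNReal.ofReal_le_ofReal h)

theorem finiteExponent_of_pos {P : BinaryDMC Y} {Q : BinaryDMC Z} {γ : ℝ} {n : ℕ}
    (h : 0 < minErrorProb P Q ⌊γ * n⌋₊ (n - ⌊γ * n⌋₊)) :
    finiteExponent P Q γ n =
      ((-(Real.log (minErrorProb P Q ⌊γ * n⌋₊ (n - ⌊γ * n⌋₊))) / n : ℝ) : EReal) := by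
  unfold finiteExponent
  rw [extLog_of_pos h]
  rfl

theorem finiteExponent_of_eq_zero {P : BinaryDMC Y} {Q : BinaryDMC Z} {γ : ℝ} {n : ℕ} (hn : 0 < n)
    (h : minErrorProb P Q ⌊γ * n⌋₊ (n - ⌊γ * n⌋₊) = 0) : finiteExponent P Q γ n = ⊤ := by
  unfold finiteExponent
  rw [extLog_of_nonpos h.le, EReal.neg_bot]
  exact EReal.top_div_of_pos_ne_top (by exact_mod_cast hn) (EReal.coe_ne_top (n : ℝ))

theorem tendsto_finiteExponent {P : BinaryDMC Y} {Q : BinaryDMC Z} (hP : Flip P) (hQ : Flip Q)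
    {γ : ℝ} (hγ : γ ∈ Icc (0 : ℝ) 1) {u v : ℝ → ℝ} (hu : ContinuousOn u (Icc 0 1))
    (hv : ContinuousOn v (Icc 0 1))
    (hPu : ∀ (n : ℕ), ∀ s ∈ Icc (0 : ℝ) 1,
      rhoCh P s ^ ⌊γ * n⌋₊ = Real.exp (⌊γ * n⌋₊ * u s))
    (hQv : ∀ (n : ℕ), ∀ s ∈ Icc (0 : ℝ) 1,
      rhoCh Q s ^ (n - ⌊γ * n⌋₊) = Real.exp ((n - ⌊γ * n⌋₊ : ℕ) * v s))
    {s₀ : ℝ} (hs₀ : s₀ ∈ Icc (0 : ℝ) 1)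
    (hmin : IsMinOn (fun s => γ * u s + (1 - γ) * v s) (Icc 0 1) s₀) :
    Tendsto (finiteExponent P Q γ) atTop
      (𝓝 ((-(γ * u s₀ + (1 - γ) * v s₀) : ℝ) : EReal)) := by
  have hb := fun {ε : ℝ} (hε : 0 < ε) =>
    eventually_exp_bounds hP hQ hγ hu hv hPu hQv hs₀ hmin hε
  have hreal : Tendsto (fun n : ℕ =>
      -(Real.log (minErrorProb P Q ⌊γ * n⌋₊ (n - ⌊γ * n⌋₊))) / n) atTop
      (𝓝 (-(γ * u s₀ + (1 - γ) * v s₀))) := by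
    refine Metric.tendsto_nhds.2 fun ε hε => ?_
    filter_upwards [hb (half_pos hε), eventually_gt_atTop 0] with n hn hn0
    have hn1 : (0 : ℝ) < n := Nat.cast_pos.2 hn0
    have hpos := (Real.exp_pos _).trans_le hn.1
    have h1 := (Real.le_log_iff_exp_le hpos).2 hn.1
    have h2 := (Real.log_le_iff_le_exp hpos).2 hn.2
    rw [Real.dist_eq, abs_lt, lt_sub_iff_add_lt, sub_lt_iff_lt_add, lt_div_iff₀ hn1,
      div_lt_iff₀ hn1]
    constructor <;> nlinarith
  refine Tendsto.congr' ?_ ((continuous_coe_real_ereal.tendsto _).comp hreal)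
  filter_upwards [hb one_pos] with n hn
  exact (finiteExponent_of_pos ((Real.exp_pos _).trans_le hn.1)).symm

theorem tendsto_finiteExponent_top {P : BinaryDMC Y} {Q : BinaryDMC Z} {γ : ℝ}
    (h : ∀ᶠ n : ℕ in atTop, rhoCh P 0 ^ ⌊γ * n⌋₊ * rhoCh Q 0 ^ (n - ⌊γ * n⌋₊) = 0) :
    Tendsto (finiteExponent P Q γ) atTop (𝓝 ⊤) := by
  refine tendsto_const_nhds.congr' ?_
  filter_upwards [h, eventually_gt_atTop 0] with n hn hn0
  refine (finiteExponent_of_eq_zero hn0 (le_antisymm ?_ (minErrorProb_nonneg P Q _ _))).symm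
  exact (minErrorProb_le_rhoCh P Q _ _ (left_mem_Icc.2 zero_le_one)).trans hn.le

/-- A channel whose output distributions do not have disjoint supports has `ρ` positive. -/
theorem rhoCh_pos {W : BinaryDMC Y} (h : rhoCh W 0 ≠ 0) (s : ℝ) : 0 < rhoCh W s :=
  (rhoCh_nonneg W s).lt_of_ne' fun h' =>
    h (rho_eq_zero_of_eq_zero (W.prob_nonneg 0) (W.prob_nonneg 1) h' 0)

theorem continuous_log_rhoCh {W : BinaryDMC Y} (h : rhoCh W 0 ≠ 0) :
    Continuous fun s => Real.log (rhoCh W s) :=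
  (continuous_rho _ _).log fun s => (rhoCh_pos h s).ne'

theorem rhoCh_pow_eq_exp {W : BinaryDMC Y} (h : rhoCh W 0 ≠ 0) (k : ℕ) (s : ℝ) :
    rhoCh W s ^ k = Real.exp (k * Real.log (rhoCh W s)) := by
  rw [Real.exp_nat_mul, Real.exp_log (rhoCh_pos h s)]

/-- With two channels that do not have disjoint supports, the error exponent is given by
Chernoff's formula. -/
theorem exists_tendsto_of_ne_zero {P : BinaryDMC Y} {Q : BinaryDMC Z} (hP : Flip P) (hQ : Flip Q)
    (hP0 : rhoCh P 0 ≠ 0) (hQ0 : rhoCh Q 0 ≠ 0) {γ : ℝ} (hγ : γ ∈ Icc (0 : ℝ) 1) :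
    ∃ s ∈ Icc (0 : ℝ) 1, Tendsto (finiteExponent P Q γ) atTop
      (𝓝 ((-(γ * Real.log (rhoCh P s) + (1 - γ) * Real.log (rhoCh Q s)) : ℝ) : EReal)) := by
  have hu := continuous_log_rhoCh hP0
  have hv := continuous_log_rhoCh hQ0
  obtain ⟨s, hs, hmin⟩ := isCompact_Icc.exists_isMinOn ⟨(0 : ℝ), left_mem_Icc.2 zero_le_one⟩
    ((continuous_const.mul hu).add (continuous_const.mul hv) : Continuous fun s =>
      γ * Real.log (rhoCh P s) + (1 - γ) * Real.log (rhoCh Q s)).continuousOn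
  exact ⟨s, hs, tendsto_finiteExponent hP hQ hγ hu.continuousOn hv.continuousOn
    (fun n s _ => rhoCh_pow_eq_exp hP0 _ s) (fun n s _ => rhoCh_pow_eq_exp hQ0 _ s) hs hmin⟩

theorem exists_tendsto_zero {P : BinaryDMC Y} {Q : BinaryDMC Z} (hP : Flip P) (hQ : Flip Q)
    (hQ0 : rhoCh Q 0 ≠ 0) :
    ∃ s ∈ Icc (0 : ℝ) 1, Tendsto (finiteExponent P Q 0) atTop
      (𝓝 ((-Real.log (rhoCh Q s) : ℝ) : EReal)) := by
  have hv := continuous_log_rhoCh hQ0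
  obtain ⟨s, hs, hmin⟩ := isCompact_Icc.exists_isMinOn ⟨(0 : ℝ), left_mem_Icc.2 zero_le_one⟩
    hv.continuousOn
  refine ⟨s, hs, ?_⟩
  -- At `γ = 0` the power of `ρ_P` is a zeroth power, hence `1` even if `ρ_P` is zero.
  have := tendsto_finiteExponent hP hQ (left_mem_Icc.2 zero_le_one) (u := fun _ => 0)
    continuousOn_const hv.continuousOn (fun n s _ => by simp)
    (fun n s _ => rhoCh_pow_eq_exp hQ0 _ s) hs (by simpa using hmin)
  simpa using this

theorem exists_tendsto_one {P : BinaryDMC Y} {Q : BinaryDMC Z} (hP : Flip P) (hQ : Flip Q)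
    (hP0 : rhoCh P 0 ≠ 0) :
    ∃ s ∈ Icc (0 : ℝ) 1, Tendsto (finiteExponent P Q 1) atTop
      (𝓝 ((-Real.log (rhoCh P s) : ℝ) : EReal)) := by
  have hu := continuous_log_rhoCh hP0
  obtain ⟨s, hs, hmin⟩ := isCompact_Icc.exists_isMinOn ⟨(0 : ℝ), left_mem_Icc.2 zero_le_one⟩
    hu.continuousOn
  refine ⟨s, hs, ?_⟩
  have := tendsto_finiteExponent hP hQ (right_mem_Icc.2 zero_le_one) (v := fun _ => 0)
    hu.continuousOn continuousOn_const (fun n s _ => rhoCh_pow_eq_exp hP0 _ s)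
    (fun n s _ => by simp) hs (by simpa using hmin)
  simpa using this

theorem tendsto_top_of_left {P : BinaryDMC Y} {Q : BinaryDMC Z} (hP0 : rhoCh P 0 = 0) {γ : ℝ}
    (hγ : 0 < γ) : Tendsto (finiteExponent P Q γ) atTop (𝓝 ⊤) := by
  refine tendsto_finiteExponent_top ?_
  have : Tendsto (fun n : ℕ => ⌊γ * n⌋₊) atTop atTop :=
    tendsto_nat_floor_atTop.comp (tendsto_natCast_atTop_atTop.const_mul_atTop hγ)
  filter_upwards [this.eventually_gt_atTop 0] with n hn
  rw [hP0, zero_pow hn.ne', zero_mul]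

theorem tendsto_top_of_right {P : BinaryDMC Y} {Q : BinaryDMC Z} (hQ0 : rhoCh Q 0 = 0) {γ : ℝ}
    (hγ0 : 0 ≤ γ) (hγ : γ < 1) : Tendsto (finiteExponent P Q γ) atTop (𝓝 ⊤) := by
  refine tendsto_finiteExponent_top ?_
  filter_upwards [eventually_gt_atTop 0] with n hn
  have hn0 : (0 : ℝ) < n := Nat.cast_pos.2 hn
  have : ⌊γ * n⌋₊ < n := (Nat.floor_lt (by positivity)).2 (by nlinarith)
  rw [hQ0, zero_pow (Nat.sub_pos_of_lt this).ne', mul_zero]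

theorem exists_tendsto {P : BinaryDMC Y} {Q : BinaryDMC Z} (hP : Flip P) (hQ : Flip Q)
    {γ : ℝ} (hγ : γ ∈ Icc (0 : ℝ) 1) : ∃ L, Tendsto (finiteExponent P Q γ) atTop (𝓝 L) := by
  by_cases hP0 : rhoCh P 0 = 0
  · rcases hγ.1.eq_or_lt with rfl | h0
    · by_cases hQ0 : rhoCh Q 0 = 0
      · exact ⟨_, tendsto_top_of_right hQ0 le_rfl one_pos⟩
      · obtain ⟨s, -, h⟩ := exists_tendsto_zero hP hQ hQ0
        exact ⟨_, h⟩
    · exact ⟨_, tendsto_top_of_left hP0 h0⟩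
  · by_cases hQ0 : rhoCh Q 0 = 0
    · rcases hγ.2.eq_or_lt with rfl | h1
      · obtain ⟨s, -, h⟩ := exists_tendsto_one hP hQ hP0
        exact ⟨_, h⟩
      · exact ⟨_, tendsto_top_of_right hQ0 hγ.1 h1⟩
    · obtain ⟨s, -, h⟩ := exists_tendsto_of_ne_zero hP hQ hP0 hQ0 hγ
      exact ⟨_, h⟩

/-! ### The minimum over `γ` and the minimax argument. -/

theorem continuous_extLog : Continuous extLog :=
  ENNReal.continuous_log.comp ENNReal.continuous_ofReal

theorem mu_eq_coe {W : BinaryDMC Y} (h : rhoCh W 0 ≠ 0) (s : ℝ) :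
    mu W s = (Real.log (rhoCh W s) : EReal) :=
  extLog_of_pos (rhoCh_pos h s)

theorem mu_eq_bot {W : BinaryDMC Y} (h : rhoCh W 0 = 0) (s : ℝ) : mu W s = ⊥ :=
  extLog_of_nonpos (rho_eq_zero_of_eq_zero (W.prob_nonneg 0) (W.prob_nonneg 1) h s).le

/-- Constant codewords give an error of at most `ρ_P^a ρ_Q^(n-a) ≤ max(ρ_P, ρ_Q)^n`, already for
each finite `n` and without the flip assumption. -/
theorem neg_max_mu_le_finiteExponent (P : BinaryDMC Y) (Q : BinaryDMC Z) {γ s : ℝ}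
    (hγ : γ ∈ Icc (0 : ℝ) 1) (hs : s ∈ Icc (0 : ℝ) 1) {n : ℕ} (hn : 0 < n) :
    -max (mu P s) (mu Q s) ≤ finiteExponent P Q γ n := by
  have hmax : max (mu P s) (mu Q s) = extLog (max (rhoCh P s) (rhoCh Q s)) :=
    (extLog_mono.map_max).symm
  set r := max (rhoCh P s) (rhoCh Q s) with hr
  have hle : minErrorProb P Q ⌊γ * n⌋₊ (n - ⌊γ * n⌋₊) ≤ r ^ n := by
    refine (minErrorProb_le_rhoCh P Q _ _ hs).trans ?_
    conv_rhs => rw [← Nat.add_sub_cancel' (floor_mul_le hγ n), pow_add]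
    have h1 := rhoCh_nonneg P s
    have h2 := rhoCh_nonneg Q s
    have h3 : 0 ≤ r := h1.trans (le_max_left _ _)
    gcongr
    · exact le_max_left _ _
    · exact le_max_right _ _
  rcases (minErrorProb_nonneg P Q ⌊γ * n⌋₊ (n - ⌊γ * n⌋₊)).eq_or_lt with h0 | h0
  · rw [finiteExponent_of_eq_zero hn h0.symm]
    exact le_top
  · have hr0 : 0 < r := by
      refine ((rhoCh_nonneg P s).trans (le_max_left _ _)).lt_of_ne' fun h => ?_
      rw [hr, h, zero_pow hn.ne'] at hle
      linarith
    rw [hmax, extLog_of_pos hr0, finiteExponent_of_pos h0, ← EReal.coe_neg, EReal.coe_le_coe_iff,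
      le_div_iff₀ (Nat.cast_pos.2 hn)]
    have := Real.log_le_log h0 hle
    rw [Real.log_pow] at this
    linarith

/-- The minimax identity: some `γ` makes all convex combinations
`γ * μ_P(s) + (1 - γ) * μ_Q(s)` at least `min_t max (μ_P(t)) (μ_Q(t))`. -/
theorem exists_saddle {P : BinaryDMC Y} {Q : BinaryDMC Z} (hP0 : rhoCh P 0 ≠ 0)
    (hQ0 : rhoCh Q 0 ≠ 0) :
    ∃ γ ∈ Icc (0 : ℝ) 1, ∃ t ∈ Icc (0 : ℝ) 1, ∀ s ∈ Icc (0 : ℝ) 1,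
      max (Real.log (rhoCh P t)) (Real.log (rhoCh Q t)) ≤
        γ * Real.log (rhoCh P s) + (1 - γ) * Real.log (rhoCh Q s) := by
  have hu := continuous_log_rhoCh hP0
  have hv := continuous_log_rhoCh hQ0
  have cu := convexOn_log_rho (P.prob_nonneg 0) (P.prob_nonneg 1) (rhoCh_pos hP0)
  have cv := convexOn_log_rho (Q.prob_nonneg 0) (Q.prob_nonneg 1) (rhoCh_pos hQ0)
  have hI : (Icc (0 : ℝ) 1).Nonempty := ⟨0, left_mem_Icc.2 zero_le_one⟩
  obtain ⟨t, ht, γ, hγ, h⟩ := Sion.exists_isSaddlePointOn (X := Icc (0 : ℝ) 1)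
    (Y := Icc (0 : ℝ) 1)
    (f := fun s γ => γ * Real.log (rhoCh P s) + (1 - γ) * Real.log (rhoCh Q s))
    hI (convex_Icc 0 1) isCompact_Icc
    (fun γ _ => ((continuous_const.mul hu).add
      (continuous_const.mul hv)).continuousOn.lowerSemicontinuousOn)
    (fun γ hγ => (((cu.smul hγ.1).add (cv.smul (sub_nonneg.2 hγ.2))).subset (subset_univ _)
      (convex_Icc 0 1)).quasiconvexOn)
    (convex_Icc 0 1) hI isCompact_Icc
    (fun s _ => (by fun_prop : Continuous fun γ =>
      γ * Real.log (rhoCh P s) + (1 - γ) * Real.log (rhoCh Q s)).continuousOn.upperSemicontinuousOn)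
    (fun s _ => by
      refine ConcaveOn.quasiconcaveOn ⟨convex_Icc 0 1, fun x _ y _ a b _ _ hab => le_of_eq ?_⟩
      simp only [smul_eq_mul]
      linear_combination (Real.log (rhoCh Q s)) * hab)
  -- Testing the saddle inequality against the weights `1` and `0` isolates the two logarithms at
  -- `t`.
  refine ⟨γ, hγ, t, ht, fun s hs => max_le ?_ ?_⟩
  · simpa using h s hs 1 (right_mem_Icc.2 zero_le_one)
  · simpa using h s hs 0 (left_mem_Icc.2 zero_le_one)

/-- Some `γ` has an error exponent of at most `-m`, where `m` is a lower bound of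
`max (μ_P(s)) (μ_Q(s))`. -/
theorem exists_tendsto_le {P : BinaryDMC Y} {Q : BinaryDMC Z} (hP : Flip P) (hQ : Flip Q)
    {m : EReal} (hm : ∀ s ∈ Icc (0 : ℝ) 1, m ≤ max (mu P s) (mu Q s)) :
    ∃ γ ∈ Icc (0 : ℝ) 1, ∃ L ≤ -m, Tendsto (finiteExponent P Q γ) atTop (𝓝 L) := by
  by_cases hP0 : rhoCh P 0 = 0
  · by_cases hQ0 : rhoCh Q 0 = 0
    · refine ⟨0, left_mem_Icc.2 zero_le_one, ⊤, ?_, tendsto_top_of_right hQ0 le_rfl one_pos⟩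
      have := hm 0 (left_mem_Icc.2 zero_le_one)
      rw [mu_eq_bot hP0, mu_eq_bot hQ0, max_self, le_bot_iff] at this
      rw [this, EReal.neg_bot]
    · obtain ⟨s, hs, h⟩ := exists_tendsto_zero hP hQ hQ0
      refine ⟨0, left_mem_Icc.2 zero_le_one, _, ?_, h⟩
      have := hm s hs
      rw [mu_eq_bot hP0, mu_eq_coe hQ0, max_eq_right bot_le] at this
      rw [EReal.coe_neg]
      exact EReal.neg_le_neg_iff.2 this
  · by_cases hQ0 : rhoCh Q 0 = 0
    · obtain ⟨s, hs, h⟩ := exists_tendsto_one hP hQ hP0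
      refine ⟨1, right_mem_Icc.2 zero_le_one, _, ?_, h⟩
      have := hm s hs
      rw [mu_eq_bot hQ0, mu_eq_coe hP0, max_eq_left bot_le] at this
      rw [EReal.coe_neg]
      exact EReal.neg_le_neg_iff.2 this
    · obtain ⟨γ, hγ, t, ht, hsad⟩ := exists_saddle hP0 hQ0
      -- The saddle inequality holds at every `s`, in particular at the one realizing the exponent
      -- for this `γ`.
      obtain ⟨s, hs, h⟩ := exists_tendsto_of_ne_zero hP hQ hP0 hQ0 hγ
      refine ⟨γ, hγ, _, ?_, h⟩
      rw [EReal.coe_neg]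
      refine EReal.neg_le_neg_iff.2 ((hm t ht).trans ?_)
      rw [mu_eq_coe hP0, mu_eq_coe hQ0, ← EReal.coe_strictMono.monotone.map_max]
      exact EReal.coe_le_coe_iff.2 (hsad s hs)

theorem flip_of_mu_le {W : BinaryDMC Y}
    (h : ∀ s ∈ Icc (0 : ℝ) (1 / 2), mu W s ≤ mu W (1 - s)) : Flip W := fun s hs =>
  (ENNReal.ofReal_le_ofReal_iff (rhoCh_nonneg W _)).1 (ENNReal.log_le_log_iff.1 (h s hs))

end Exponents

end TwoRound

end

theorem mainTheorem6 {Y Z : Type*} [Fintype Y] [Fintype Z]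
    (P : TwoRound.BinaryDMC Y) (Q : TwoRound.BinaryDMC Z)
    (h : TwoRound.FlipAssumption P Q) :
    (∀ γ ∈ Set.Icc (0 : ℝ) 1,
      Filter.Tendsto (TwoRound.finiteExponent P Q γ) Filter.atTop
        (nhds (TwoRound.E1 P Q γ))) ∧
    ∃ m : EReal,
      IsLeast ((fun s : ℝ => max (TwoRound.mu P s) (TwoRound.mu Q s)) '' Set.Icc (0 : ℝ) 1) m ∧
      IsLeast (TwoRound.E1 P Q '' Set.Icc (0 : ℝ) 1) (-m) := by
  have hP := TwoRound.flip_of_mu_le fun s hs => (h s hs).1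
  have hQ := TwoRound.flip_of_mu_le fun s hs => (h s hs).2
  have hlim : ∀ γ ∈ Set.Icc (0 : ℝ) 1, Filter.Tendsto (TwoRound.finiteExponent P Q γ)
      Filter.atTop (nhds (TwoRound.E1 P Q γ)) := fun γ hγ => by
    obtain ⟨L, hL⟩ := TwoRound.exists_tendsto hP hQ hγ
    have hE : TwoRound.E1 P Q γ = L := hL.limsup_eq
    rwa [hE]
  refine ⟨hlim, ?_⟩
  have hcont : Continuous fun s => max (TwoRound.mu P s) (TwoRound.mu Q s) :=
    (TwoRound.continuous_extLog.comp (TwoRound.continuous_rho _ _)).max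
      (TwoRound.continuous_extLog.comp (TwoRound.continuous_rho _ _))
  obtain ⟨t, ht, hmin⟩ := isCompact_Icc.exists_isMinOn
    ⟨(0 : ℝ), Set.left_mem_Icc.2 zero_le_one⟩ hcont.continuousOn
  have hlow : ∀ γ ∈ Set.Icc (0 : ℝ) 1,
      -max (TwoRound.mu P t) (TwoRound.mu Q t) ≤ TwoRound.E1 P Q γ := fun γ hγ => by
    refine ge_of_tendsto (hlim γ hγ) ?_
    filter_upwards [Filter.eventually_gt_atTop 0] with n hn
    exact TwoRound.neg_max_mu_le_finiteExponent P Q hγ ht hn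
  refine ⟨_, ⟨Set.mem_image_of_mem _ ht, ?_⟩, ?_, ?_⟩
  · rintro _ ⟨s, hs, rfl⟩
    exact hmin hs
  · obtain ⟨γ, hγ, L, hL, hT⟩ := TwoRound.exists_tendsto_le hP hQ
      (m := max (TwoRound.mu P t) (TwoRound.mu Q t)) fun s hs => hmin hs
    have hE : TwoRound.E1 P Q γ = L := hT.limsup_eq
    exact ⟨γ, hγ, le_antisymm (hE.trans_le hL) (hlow γ hγ)⟩
  · rintro _ ⟨γ, hγ, rfl⟩
    exact hlow γ hγ
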